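/- Let $G = SU(2)$, with elements written $x = \begin{pmatrix} z_1 & -\bar z_2 \\ z_2 & \bar z_1\end{pmatrix}$, $|z_1|^2+|z_2|^2 = 1$, and let $H \cong U(1)$ be its diagonal subgroup. View the two-sphere as $S^2 = G/H$, with the distance $\hat\rho$ of the Riemannian metric on $G/H$ induced by the bi-invariant Riemannian metric on $G$ that comes from the inner product $\langle X, Y\rangle = \tfrac12 \operatorname{tr}(XY^*)$ on $su(2)$. For a function $F : S^2 \to M_2(\mathbb C)$ put $$L(F) = \sup\{\|F(a)-F(b)\|/\hat\rho(a,b) : a, b \in S^2,\ a \neq b\},$$ with the operator norm on $M_2(\mathbb C)$. Let $n \in \mathbb Z$, $n \neq 0$, let $h(x) = (|z_1|^{2|n|}+|z_2|^{2|n|})^{-1/2}$, and let $u(x) = h(x)(z_1^n, z_2^n)'$ if $n > 0$ and $u(x) = h(x)(\bar z_1^{|n|}, \bar z_2^{|n|})'$ if $n < 0$ (the prime denotes transpose), which is a unit vector in $\mathbb C^2$. Let $p$ be the function on $S^2$ whose value $p(xH)$ is the rank-one orthogonal projection $v \mapsto u(x)\langle u(x), v\rangle$ of $\mathbb C^2$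 onto $\mathbb C u(x)$ (with inner product linear in the second variable); this depends only on the coset $xH$. Then $$|n| \le L(p) \le |n|\sqrt 2 .$$ -/

import Mathlib

open scoped ComplexConjugate ENNReal Matrix.Norms.L2Operator

namespace Monopole

noncomputable section

/-- `2 × 2` complex matrices; with the opened scope, `‖·‖` is their norm as operators on the
Hilbert space `ℂ²`. -/
abbrev M2 : Type := Matrix (Fin 2) (Fin 2) ℂ

/-- The group `G = SU(2)`. -/
abbrev SU2 : Type := Matrix.specialUnitaryGroup (Fin 2) ℂ

/-- The diagonal subgroup `H ≅ U(1)` of `SU(2)`, consisting of the `diag(z, z̄)` with `|z| = 1`. -/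
def diagSubgroup : Subgroup SU2 where
  carrier := {s | s.1 0 1 = 0 ∧ s.1 1 0 = 0}
  one_mem' := by simp
  mul_mem' := by
    rintro a b ⟨ha, ha'⟩ ⟨hb, hb'⟩
    simp [Matrix.mul_apply, Fin.sum_univ_two, ha, ha', hb, hb']
  inv_mem' := by
    rintro a ⟨ha, ha'⟩
    have h : (a⁻¹ : SU2).1 = star a.1 := rfl
    simp [h, Matrix.star_apply, ha, ha']

/-- The two-sphere, as the homogeneous space `G/H = SU(2)/U(1)`. -/
abbrev S2 : Type := SU2 ⧸ diagSubgroup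

/-! ### The metric -/

/-- The norm on `su(2)` of the `Ad`-invariant inner product `⟨X, Y⟩ = ½ tr (X Y*)`. -/
def gNorm (X : M2) : ℝ := Real.sqrt ((X * X.conjTranspose).trace.re / 2)

/-- The orthogonal projection of `su(2)` onto the orthogonal complement `𝔪` of the Lie algebra `𝔥`
of `H` (`𝔥` consists of the diagonal matrices in `su(2)`, so `𝔪` of those with zero diagonal). -/
def projM (X : M2) : M2 := !![0, X 0 1; X 1 0, 0]

/-- The length, for the Riemannian metric on `G/H` induced by that of `G`, of the curve
`t ↦ γ(t)H`, `0 ≤ t ≤ 1`. The tangent space of `G/H` at `xH` is `𝔪`, by means of `x`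
(another choice of `x` in `xH` alters this by a map `Ad_s`, `s ∈ H`, which is isometric on `𝔪`);
the velocity of the curve at `t` is then the component in `𝔪` of `γ(t)⁻¹ γ'(t) ∈ su(2)`. -/
def quotientLength (γ : ℝ → SU2) : ℝ≥0∞ :=
  ∫⁻ t in Set.Icc (0 : ℝ) 1, ENNReal.ofReal (gNorm (projM
    ((γ t).1.conjTranspose * derivWithin (fun r => (γ r).1) (Set.Icc 0 1) t)))

/-- The Riemannian distance on `S² = G/H`: the infimum of the lengths of the `C¹` curves from `a`
to `b`. Since `G → G/H` is a locally trivial bundle, the `C¹` curves in `G/H` are exactly the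
`t ↦ γ(t)H` with `γ` a `C¹` curve in `G`. -/
def sphereEDist (a b : S2) : ℝ≥0∞ :=
  ⨅ (γ : ℝ → SU2) (_ : ContDiffOn ℝ 1 (fun t => (γ t).1) (Set.Icc 0 1))
    (_ : (QuotientGroup.mk (γ 0) : S2) = a) (_ : (QuotientGroup.mk (γ 1) : S2) = b),
    quotientLength γ

/-- The Lipschitz seminorm `L(F) ∈ [0, ∞]` of a matrix-valued function on `S²`, with respect to the
Riemannian distance of `S²` and the operator norm of matrices. -/
def lipSeminorm (F : S2 → M2) : ℝ≥0∞ :=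
  ⨆ (a : S2) (b : S2) (_ : a ≠ b), ENNReal.ofReal ‖F a - F b‖ / sphereEDist a b

/-! ### The projection -/

/-- The function `h(x) = (|z₁|^{2|n|} + |z₂|^{2|n|})^{-1/2}`, where `(z₁, z₂)` is the first
column of `x`. -/
def hFun (n : ℤ) (x : SU2) : ℝ :=
  (Real.sqrt (‖x.1 0 0‖ ^ (2 * n.natAbs) + ‖x.1 1 0‖ ^ (2 * n.natAbs)))⁻¹

/-- The function `u(x) = h(x) (z₁ⁿ, z₂ⁿ)'` if `n > 0`, and
`u(x) = h(x) (z̄₁^{|n|}, z̄₂^{|n|})'` if `n < 0`. -/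
def uFun (n : ℤ) (x : SU2) : Fin 2 → ℂ := fun j =>
  (hFun n x : ℂ) * (if 0 < n then x.1 j 0 else conj (x.1 j 0)) ^ n.natAbs

/-- The rank-one operator `v ↦ u(x) ⟨u(x), v⟩` determined by `u(x)`, that is, the matrix with
entries `u_j(x)` times the conjugate of `u_k(x)`. -/
def projG (n : ℤ) (x : SU2) : M2 := Matrix.vecMulVec (uFun n x) (star (uFun n x))

lemma mul_diag_apply (x s : SU2) (hs : s ∈ diagSubgroup) (j : Fin 2) :
    (x * s).1 j 0 = x.1 j 0 * s.1 0 0 := by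
  have h : s.1 1 0 = 0 := hs.2
  simp [Matrix.mul_apply, Fin.sum_univ_two, h]

lemma diag_unit (s : SU2) (hs : s ∈ diagSubgroup) : s.1 0 0 * conj (s.1 0 0) = 1 := by
  have h1 : s.1 * star s.1 = 1 := (Matrix.mem_specialUnitaryGroup_iff.1 s.2).1.2
  have h := congrFun (congrFun h1 0) 0
  have h0 : s.1 0 1 = 0 := hs.1
  simpa [Matrix.mul_apply, Fin.sum_univ_two, h0] using h

lemma diag_norm (s : SU2) (hs : s ∈ diagSubgroup) : ‖s.1 0 0‖ = 1 := by
  have h := congrArg norm (diag_unit s hs)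
  simp only [norm_mul, RCLike.norm_conj, norm_one] at h
  nlinarith [norm_nonneg (s.1 0 0)]

lemma projG_mul_diag (n : ℤ) (x s : SU2) (hs : s ∈ diagSubgroup) :
    projG n (x * s) = projG n x := by
  have hh : hFun n (x * s) = hFun n x := by
    simp only [hFun, mul_diag_apply x s hs, norm_mul, diag_norm s hs, mul_one]
  have e := diag_unit s hs
  ext j k
  simp only [projG, Matrix.vecMulVec_apply, Pi.star_apply, uFun, hh, mul_diag_apply x s hs]
  by_cases hn : 0 < n
  · simp only [if_pos hn, star_mul', star_pow, mul_pow, RCLike.star_def]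
    have e' : (s.1 0 0) ^ n.natAbs * (conj (s.1 0 0)) ^ n.natAbs = 1 := by
      rw [← mul_pow, e, one_pow]
    linear_combination (hFun n x : ℂ) * (x.1 j 0) ^ n.natAbs * conj (hFun n x : ℂ)
      * (conj (x.1 k 0)) ^ n.natAbs * e'
  · simp only [if_neg hn, star_mul', star_pow, mul_pow, RCLike.star_def, map_mul,
      Complex.conj_conj]
    have e' : (s.1 0 0) ^ n.natAbs * (conj (s.1 0 0)) ^ n.natAbs = 1 := by
      rw [← mul_pow, e, one_pow]
    linear_combination (hFun n x : ℂ) * (conj (x.1 j 0)) ^ n.natAbs * conj (hFun n x : ℂ)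
      * (x.1 k 0) ^ n.natAbs * e'

/-- The projection-valued function `p` on `S² = G/H`, with `p(xH)` the rank-one operator
determined by the unit vector `u(x)`. -/
def proj (n : ℤ) : S2 → M2 :=
  Quotient.lift (projG n) (by
    intro x y hxy
    have h : x⁻¹ * y ∈ diagSubgroup := QuotientGroup.leftRel_apply.1 hxy
    have h2 := projG_mul_diag n x (x⁻¹ * y) h
    rw [mul_inv_cancel_left] at h2
    exact h2.symm)

lemma norm_u (n : ℤ) (x : SU2) : star (uFun n x) ⬝ᵥ uFun n x = 1 := by
  have h1 : star x.1 * x.1 = 1 := (Matrix.mem_specialUnitaryGroup_iff.1 x.2).1.1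
  have h := congrFun (congrFun h1 0) 0
  simp only [Matrix.mul_apply, Fin.sum_univ_two, Matrix.star_apply, RCLike.star_def,
    Complex.conj_mul', Matrix.one_apply_eq] at h
  have h' : ‖x.1 0 0‖ ^ 2 + ‖x.1 1 0‖ ^ 2 = 1 := by exact_mod_cast h
  set S : ℝ := ‖x.1 0 0‖ ^ (2 * n.natAbs) + ‖x.1 1 0‖ ^ (2 * n.natAbs) with hS
  have hpos : 0 < S := by
    by_cases h0 : ‖x.1 0 0‖ = 0
    · have h2 : 0 < ‖x.1 1 0‖ := by
        rcases (norm_nonneg (x.1 1 0)).lt_or_eq with h3 | h3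
        · exact h3
        · rw [h0, ← h3] at h'; norm_num at h'
      positivity
    · have h2 : 0 < ‖x.1 0 0‖ := lt_of_le_of_ne (norm_nonneg _) (Ne.symm h0)
      positivity
  have key : ∀ j, star (uFun n x j) * uFun n x j
      = (((hFun n x) ^ 2 * ‖x.1 j 0‖ ^ (2 * n.natAbs) : ℝ) : ℂ) := by
    intro j
    rw [RCLike.star_def, Complex.conj_mul']
    unfold uFun
    rw [norm_mul, norm_pow, Complex.norm_real, Real.norm_eq_abs, ← Complex.ofReal_pow,
      mul_pow, sq_abs]
    split_ifs <;> simp [pow_mul']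
  simp only [dotProduct, Fin.sum_univ_two, Pi.star_apply, key]
  rw [← Complex.ofReal_add, ← mul_add, ← hS]
  have : hFun n x ^ 2 = S⁻¹ := by
    rw [hFun, inv_pow, ← hS, Real.sq_sqrt hpos.le]
  rw [this, inv_mul_cancel₀ hpos.ne', Complex.ofReal_one]

/-- The values of `p` are orthogonal projections. -/
theorem isStarProjection_proj (n : ℤ) (a : S2) : IsStarProjection (proj n a) := by
  induction a using Quotient.inductionOn with
  | h x =>
    change IsStarProjection (projG n x)
    refine ⟨?_, ?_⟩
    · rw [IsIdempotentElem, projG, Matrix.vecMulVec_mul_vecMulVec, norm_u]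
      simp
    · ext j k
      simp [projG, Matrix.star_apply, Matrix.vecMulVec_apply, mul_comm]

end

end Monopole

/-! Write N = |n| and let (z₁, z₂) be the first column of x, conjugated if n < 0. Then p is the
projection onto the line of (z₁^N, z₂^N), and `exists_hasDerivAt_lineProj` gives the operator-norm
speed of a moving line as Wronskian over squared length. Along a curve this is N |z₁z₂|^(N-1) |z₁z₂'
- z₂z₁'| / (|z₁|^(2N) + |z₂|^(2N)). The last factor of the numerator is the modulus of an
off-diagonal entry of γ*γ', which the speed in G/H controls; the rest is at most N by
`mul_pow_le_pow_add_pow`. Integrating along curves and taking the infimum of lengths gives the upper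
bound.

For the lower bound, equatorial points joined by an arc of length ψ have p-values at distance |sin
nψ|; divide by ψ and let ψ → 0. -/

namespace Monopole

noncomputable section

/-! ### Projections onto lines in ℂ² and their speed -/

/-- A traceless Hermitian `2 × 2` matrix has a scalar square, which gives its operator norm. -/
lemma norm_sq_of_isHermitian_of_trace_eq_zero {A : M2} (hA : A.IsHermitian) (ht : A.trace = 0) :
    ‖A‖ ^ 2 = ‖A 0 0‖ ^ 2 + ‖A 1 0‖ ^ 2 := by
  have h11 : A 1 1 = -A 0 0 := by
    rw [Matrix.trace_fin_two] at ht
    linear_combination ht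
  have h00 : conj (A 0 0) = A 0 0 := hA.apply 0 0
  have h01 : A 0 1 = conj (A 1 0) := (hA.apply 0 1).symm
  have hsq : A.conjTranspose * A = Matrix.diagonal (fun _ => ((‖A 0 0‖ ^ 2 + ‖A 1 0‖ ^ 2 : ℝ) : ℂ)) := by
    have e0 := Complex.conj_mul' (A 0 0)
    have e1 := Complex.conj_mul' (A 1 0)
    ext i j
    fin_cases i <;> fin_cases j <;>
      simp [Matrix.mul_apply, h01, h11, h00, ← e0, ← e1] <;> ring
  rw [sq, ← Matrix.l2_opNorm_conjTranspose_mul_self, hsq, Matrix.l2_opNorm_diagonal,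
    pi_norm_const, Complex.norm_real, Real.norm_of_nonneg (by positivity)]

/-- The orthogonal projection of `ℂ²` onto the line spanned by `(a, b)`. -/
def lineProj (a b : ℂ) : M2 :=
  !![a * conj a / (a * conj a + b * conj b), a * conj b / (a * conj a + b * conj b);
     b * conj a / (a * conj a + b * conj b), b * conj b / (a * conj a + b * conj b)]

lemma isHermitian_lineProj (a b : ℂ) : (lineProj a b).IsHermitian := by
  ext i j
  fin_cases i <;> fin_cases j <;> simp [lineProj, mul_comm]

lemma mul_conj_add_mul_conj (a b : ℂ) :
    a * conj a + b * conj b = ((‖a‖ ^ 2 + ‖b‖ ^ 2 : ℝ) : ℂ) := by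
  simp [Complex.mul_conj']

/-- The speed of a curve of projections onto lines, for the operator norm. -/
lemma exists_hasDerivAt_lineProj {a b : ℝ → ℂ} {a' b' : ℂ} {t : ℝ}
    (ha : HasDerivAt a a' t) (hb : HasDerivAt b b' t) (h0 : 0 < ‖a t‖ ^ 2 + ‖b t‖ ^ 2) :
    ∃ P : M2, HasDerivAt (fun s => lineProj (a s) (b s)) P t ∧
      ‖P‖ = ‖a t * b' - b t * a'‖ / (‖a t‖ ^ 2 + ‖b t‖ ^ 2) := by
  have hD0 : a t * conj (a t) + b t * conj (b t) ≠ 0 := by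
    rw [mul_conj_add_mul_conj]
    exact_mod_cast h0.ne'
  have hac : HasDerivAt (fun s => conj (a s)) (conj a') t := ha.star
  have hbc : HasDerivAt (fun s => conj (b s)) (conj b') t := hb.star
  have hD := (ha.fun_mul hac).fun_add (hb.fun_mul hbc)
  have h00 := (ha.fun_mul hac).fun_div hD hD0
  have h01 := (ha.fun_mul hbc).fun_div hD hD0
  have h10 := (hb.fun_mul hac).fun_div hD hD0
  have h11 := (hb.fun_mul hbc).fun_div hD hD0
  set A := a t
  set B := b t
  set D := A * conj A + B * conj B with hDdef
  set W := A * b' - B * a' with hW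
  -- The line depends only on the ratio of `a` and `b`, so the quotient rule collapses to terms
  -- containing the Wronskian `W` or its conjugate.
  let P : M2 := !![-(conj A * conj B * W + A * B * conj W) / D ^ 2,
      (A ^ 2 * conj W - conj B ^ 2 * W) / D ^ 2;
      (conj A ^ 2 * W - B ^ 2 * conj W) / D ^ 2,
      (conj A * conj B * W + A * B * conj W) / D ^ 2]
  have hDc : conj D = D := by simp [hDdef, mul_comm]
  refine ⟨P, ?_, ?_⟩
  · have key : HasDerivAt (fun s i j => lineProj (a s) (b s) i j) (fun i j => P i j) t := by
      refine hasDerivAt_pi.2 fun i => hasDerivAt_pi.2 fun j => ?_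
      fin_cases i <;> fin_cases j
      · refine h00.congr_deriv ?_
        simp [P, hW]; ring
      · refine h01.congr_deriv ?_
        simp [P, hW]; ring
      · refine h10.congr_deriv ?_
        simp [P, hW]; ring
      · refine h11.congr_deriv ?_
        simp [P, hW]; ring
    exact key
  · have hP : P.IsHermitian := by
      ext i j
      fin_cases i <;> fin_cases j <;> simp [P, hDc] <;> ring
    have hPt : P.trace = 0 := by
      rw [Matrix.trace_fin_two]
      simp [P]; ring
    have hn := norm_sq_of_isHermitian_of_trace_eq_zero hP hPt
    have hDn : D = ((‖A‖ ^ 2 + ‖B‖ ^ 2 : ℝ) : ℂ) := mul_conj_add_mul_conj A B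
    have hsq : ‖P‖ ^ 2 = (‖W‖ / (‖A‖ ^ 2 + ‖B‖ ^ 2)) ^ 2 := by
      rw [hn]
      -- In ℂ the squared moduli become products with conjugates, and the claim is a polynomial
      -- identity.
      have : ((‖P 0 0‖ ^ 2 + ‖P 1 0‖ ^ 2 : ℝ) : ℂ)
          = (((‖W‖ / (‖A‖ ^ 2 + ‖B‖ ^ 2)) ^ 2 : ℝ) : ℂ) := by
        rw [← mul_conj_add_mul_conj, div_pow, Complex.ofReal_div, Complex.ofReal_pow,
          Complex.ofReal_pow, ← hDn, ← Complex.mul_conj']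
        simp only [P, Matrix.of_apply, Matrix.cons_val', Matrix.cons_val_zero, Matrix.cons_val_one,
          map_div₀, map_neg, map_add, map_sub, map_mul, map_pow, hDc, Complex.conj_conj]
        field_simp
        simp only [hDdef]
        ring
      exact_mod_cast this
    exact (sq_eq_sq₀ (norm_nonneg _) (by positivity)).1 hsq

/-! ### First columns in SU(2) and pointwise estimates -/

lemma norm_sq_add_norm_sq (x : SU2) : ‖x.1 0 0‖ ^ 2 + ‖x.1 1 0‖ ^ 2 = 1 := by
  have h1 : star x.1 * x.1 = 1 := (Matrix.mem_specialUnitaryGroup_iff.1 x.2).1.1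
  have h := congrFun (congrFun h1 0) 0
  simp only [Matrix.mul_apply, Fin.sum_univ_two, Matrix.star_apply, RCLike.star_def,
    Complex.conj_mul', Matrix.one_apply_eq] at h
  exact_mod_cast h

/-- With determinant 1, the adjugate is the inverse, hence the adjoint; compare entries. -/
lemma col_one (x : SU2) : x.1 0 1 = -conj (x.1 1 0) ∧ x.1 1 1 = conj (x.1 0 0) := by
  obtain ⟨hu, hd⟩ := Matrix.mem_specialUnitaryGroup_iff.1 x.2
  have h1 : star x.1 * x.1 = 1 := hu.1
  have h2 : x.1.adjugate = star x.1 := by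
    calc x.1.adjugate = (star x.1 * x.1) * x.1.adjugate := by rw [h1, one_mul]
      _ = star x.1 := by rw [mul_assoc, Matrix.mul_adjugate, hd, one_smul, mul_one]
  rw [Matrix.adjugate_fin_two] at h2
  have e0 := congrFun (congrFun h2 0) 0
  have e1 := congrFun (congrFun h2 0) 1
  simp [Matrix.star_apply] at e0 e1
  exact ⟨by rw [← e1, neg_neg], e0⟩

/-- The square of h is the reciprocal of the squared length of the vector of powers, so the square
root disappears before differentiation. -/
lemma projG_eq_lineProj (n : ℤ) (x : SU2) : projG n x =
    lineProj ((if 0 < n then x.1 0 0 else conj (x.1 0 0)) ^ n.natAbs)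
      ((if 0 < n then x.1 1 0 else conj (x.1 1 0)) ^ n.natAbs) := by
  have hc : (hFun n x : ℂ) * hFun n x =
      (((‖x.1 0 0‖ ^ (2 * n.natAbs) + ‖x.1 1 0‖ ^ (2 * n.natAbs) : ℝ) : ℂ))⁻¹ := by
    rw [← Complex.ofReal_mul, ← Complex.ofReal_inv, hFun, ← mul_inv, Real.mul_self_sqrt]
    positivity
  have hD : ∀ z : ℂ, ‖(if 0 < n then z else conj z) ^ n.natAbs‖ ^ 2 = ‖z‖ ^ (2 * n.natAbs) := by
    intro z
    rw [norm_pow, ← pow_mul, mul_comm]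
    split_ifs <;> simp
  have key : ∀ j k, projG n x j k = (if 0 < n then x.1 j 0 else conj (x.1 j 0)) ^ n.natAbs *
      conj ((if 0 < n then x.1 k 0 else conj (x.1 k 0)) ^ n.natAbs) *
      ((hFun n x : ℂ) * hFun n x) := by
    intro j k
    simp only [projG, Matrix.vecMulVec_apply, Pi.star_apply, uFun, star_mul', RCLike.star_def,
      Complex.conj_ofReal]
    ring
  ext j k
  rw [key, hc, ← hD, ← hD, ← mul_conj_add_mul_conj, ← div_eq_mul_inv]
  fin_cases j <;> fin_cases k <;> rfl

/-- After multiplication by 2^(N-1), the number 1 separates the two sides: 2ab ≤ 1 on the left, the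
power mean inequality on the right. For N ≥ 1 equality holds at a = b, the equator. -/
lemma mul_pow_le_pow_add_pow {a b : ℝ} (h : a ^ 2 + b ^ 2 = 1) (ha : 0 ≤ a) (hb : 0 ≤ b)
    (N : ℕ) : (a * b) ^ (N - 1) ≤ (a ^ N) ^ 2 + (b ^ N) ^ 2 := by
  have h1 := add_pow_le (sq_nonneg a) (sq_nonneg b) N
  rw [h, one_pow] at h1
  have h2 : (2 * (a * b)) ^ (N - 1) ≤ 1 :=
    pow_le_one₀ (by positivity) (by nlinarith [sq_nonneg (a - b)])
  rw [mul_pow] at h2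
  have h3 : (2 : ℝ) ^ (N - 1) * (a * b) ^ (N - 1)
      ≤ 2 ^ (N - 1) * ((a ^ N) ^ 2 + (b ^ N) ^ 2) := by
    refine h2.trans (h1.trans_eq ?_)
    ring
  exact le_of_mul_le_mul_left h3 (by positivity)

/-- Discarding the other off-diagonal entry costs the factor √2 of the theorem. It holds for every
matrix; skew-Hermitian ones would not need the factor. -/
lemma norm_le_sqrt_two_mul_gNorm (X : M2) : ‖X 1 0‖ ≤ Real.sqrt 2 * gNorm (projM X) := by
  rw [gNorm, ← Real.sqrt_mul (by norm_num)]
  refine Real.le_sqrt_of_sq_le ?_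
  have : (projM X * (projM X).conjTranspose).trace = ((‖X 0 1‖ ^ 2 + ‖X 1 0‖ ^ 2 : ℝ) : ℂ) := by
    rw [← mul_conj_add_mul_conj, Matrix.trace_fin_two]
    simp [projM, Matrix.mul_apply]
  rw [this, Complex.ofReal_re]
  nlinarith [sq_nonneg ‖X 0 1‖]

lemma gNorm_projM_eq {X : M2} (h : ‖X 0 1‖ = ‖X 1 0‖) : gNorm (projM X) = ‖X 1 0‖ := by
  have : (projM X * (projM X).conjTranspose).trace = ((‖X 0 1‖ ^ 2 + ‖X 1 0‖ ^ 2 : ℝ) : ℂ) := by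
    rw [← mul_conj_add_mul_conj, Matrix.trace_fin_two]
    simp [projM, Matrix.mul_apply]
  rw [gNorm, this, Complex.ofReal_re, h, add_self_div_two, Real.sqrt_sq (norm_nonneg _)]


/-! ### Lengths of curves -/

lemma continuous_gNorm_projM : Continuous fun X : M2 => gNorm (projM X) := by
  have : Continuous projM := by
    refine continuous_matrix fun i j => ?_
    fin_cases i <;> fin_cases j <;> simp [projM] <;> fun_prop
  unfold gNorm
  fun_prop

/-- The speed of `t ↦ γ(t)H` on the unit interval. -/
def speed (γ : ℝ → SU2) (t : ℝ) : ℝ :=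
  gNorm (projM ((γ t).1.conjTranspose * derivWithin (fun r => (γ r).1) (Set.Icc 0 1) t))

lemma continuousOn_speed {γ : ℝ → SU2}
    (hγ : ContDiffOn ℝ 1 (fun t => (γ t).1) (Set.Icc 0 1)) :
    ContinuousOn (speed γ) (Set.Icc 0 1) := by
  have h1 : ContinuousOn (fun t => (γ t).1) (Set.Icc (0 : ℝ) 1) := hγ.continuousOn
  have h2 := hγ.continuousOn_derivWithin (uniqueDiffOn_Icc zero_lt_one) le_rfl
  have h3 : ContinuousOn (fun t => (γ t).1.conjTranspose) (Set.Icc (0 : ℝ) 1) :=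
    continuous_star.comp_continuousOn h1
  exact continuous_gNorm_projM.comp_continuousOn (h3.mul h2)

lemma quotientLength_eq {γ : ℝ → SU2} (hγ : ContDiffOn ℝ 1 (fun t => (γ t).1) (Set.Icc 0 1)) :
    quotientLength γ = ENNReal.ofReal (∫ t in (0 : ℝ)..1, speed γ t) := by
  rw [intervalIntegral.integral_of_le zero_le_one, ← MeasureTheory.integral_Icc_eq_integral_Ioc,
    MeasureTheory.ofReal_integral_eq_lintegral_ofReal]
  · rfl
  · exact (continuousOn_speed hγ).integrableOn_Icc
  · exact Filter.Eventually.of_forall fun t => Real.sqrt_nonneg _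

/-! ### The upper bound -/

lemma hasDerivAt_entry {g : ℝ → M2} {G : M2} {t : ℝ} (h : HasDerivAt g G t) (i j : Fin 2) :
    HasDerivAt (fun s => g s i j) (G i j) t := by
  have : HasDerivAt (fun s i j => g s i j) (fun i j => G i j) t := h
  exact hasDerivAt_pi.1 (hasDerivAt_pi.1 this i) j

lemma exists_hasDerivAt_projG (n : ℤ) {γ : ℝ → SU2} {G : M2} {t : ℝ}
    (h : HasDerivAt (fun s => (γ s).1) G t) :
    ∃ P : M2, HasDerivAt (fun s => projG n (γ s)) P t ∧
      ‖P‖ ≤ |(n : ℝ)| * Real.sqrt 2 * gNorm (projM ((γ t).1.conjTranspose * G)) := by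
  set N := n.natAbs with hN
  have hNn : (N : ℝ) = |(n : ℝ)| := by rw [hN, Nat.cast_natAbs, Int.cast_abs]
  set z : Fin 2 → ℝ → ℂ := fun j s => if 0 < n then (γ s).1 j 0 else conj ((γ s).1 j 0) with hz
  set z' : Fin 2 → ℂ := fun j => if 0 < n then G j 0 else conj (G j 0) with hz'
  have hzd : ∀ j, HasDerivAt (z j) (z' j) t := by
    intro j
    by_cases hn : 0 < n
    · simpa [hz, hz', hn] using hasDerivAt_entry h j 0
    · simpa [hz, hz', hn] using (hasDerivAt_entry h j 0).star
  have hzn : ∀ j, ‖z j t‖ = ‖(γ t).1 j 0‖ := by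
    intro j
    by_cases hn : 0 < n <;> simp [hz, hn]
  have hone : ‖z 0 t‖ ^ 2 + ‖z 1 t‖ ^ 2 = 1 := by
    rw [hzn, hzn]
    exact norm_sq_add_norm_sq _
  have hle := mul_pow_le_pow_add_pow hone (norm_nonneg _) (norm_nonneg _) N
  have hpos : 0 < ‖z 0 t ^ N‖ ^ 2 + ‖z 1 t ^ N‖ ^ 2 := by
    by_cases h0 : z 0 t = 0
    · have : z 1 t ≠ 0 := by
        intro h1
        simp [h0, h1] at hone
      have := norm_pos_iff.2 (pow_ne_zero N this)
      positivity
    · have := norm_pos_iff.2 (pow_ne_zero N h0)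
      positivity
  obtain ⟨P, hP, hPn⟩ := exists_hasDerivAt_lineProj ((hzd 0).pow N) ((hzd 1).pow N) hpos
  refine ⟨P, ?_, ?_⟩
  · refine hP.congr_of_eventuallyEq (Filter.Eventually.of_forall fun s => ?_)
    exact projG_eq_lineProj n (γ s)
  -- The second column of `γ t` is (-z̄₂, z̄₁), so pairing it with the first column of `G` produces
  -- the Wronskian.
  have hw : ‖z 0 t * z' 1 - z 1 t * z' 0‖ = ‖((γ t).1.conjTranspose * G) 1 0‖ := by
    obtain ⟨h1, h2⟩ := col_one (γ t)
    have e : ((γ t).1.conjTranspose * G) 1 0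
        = (γ t).1 0 0 * G 1 0 - (γ t).1 1 0 * G 0 0 := by
      simp [Matrix.mul_apply, h1, h2]
      ring
    rw [e]
    by_cases hn : 0 < n
    · simp [hz, hz', hn]
    · simp only [hz, hz', hn, if_false]
      rw [← map_mul, ← map_mul, ← map_sub, RCLike.norm_conj]
  have hW : (z 0 ^ N) t * (N * z 1 t ^ (N - 1) * z' 1) - (z 1 ^ N) t * (N * z 0 t ^ (N - 1) * z' 0)
      = N * (z 0 t * z 1 t) ^ (N - 1) * (z 0 t * z' 1 - z 1 t * z' 0) := by
    simp only [Pi.pow_apply]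
    -- Truncated subtraction in `N - 1` is harmless at 0, where the factor `N` kills both sides.
    rcases Nat.eq_zero_or_pos N with h0 | h0
    · simp [h0]
    · obtain ⟨k, hk⟩ := Nat.exists_eq_add_of_le' h0
      rw [hk, Nat.add_sub_cancel]
      ring
  rw [hPn, hW, norm_mul, norm_mul, norm_pow, norm_mul, Complex.norm_natCast, hNn, hw]
  simp only [Pi.pow_apply] at hpos ⊢
  rw [div_le_iff₀ hpos]
  rw [← norm_pow (z 0 t), ← norm_pow (z 1 t)] at hle
  have hX := norm_le_sqrt_two_mul_gNorm ((γ t).1.conjTranspose * G)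
  calc |(n : ℝ)| * (‖z 0 t‖ * ‖z 1 t‖) ^ (N - 1) * ‖((γ t).1.conjTranspose * G) 1 0‖
      ≤ |(n : ℝ)| * (‖z 0 t ^ N‖ ^ 2 + ‖z 1 t ^ N‖ ^ 2) *
        (Real.sqrt 2 * gNorm (projM ((γ t).1.conjTranspose * G))) := by gcongr
    _ = _ := by ring

/-- The mean value inequality needs the derivative only on the open interval, where `derivWithin` is
a true derivative; continuity covers the endpoints. -/
lemma norm_projG_sub_le (n : ℤ) {γ : ℝ → SU2}
    (hγ : ContDiffOn ℝ 1 (fun t => (γ t).1) (Set.Icc 0 1)) :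
    ENNReal.ofReal ‖projG n (γ 1) - projG n (γ 0)‖ ≤
      ENNReal.ofReal (|(n : ℝ)| * Real.sqrt 2) * quotientLength γ := by
  rw [quotientLength_eq hγ, ← ENNReal.ofReal_mul (by positivity),
    ← intervalIntegral.integral_const_mul]
  refine ENNReal.ofReal_le_ofReal ?_
  have hd : ∀ t ∈ Set.Ioo (0 : ℝ) 1, HasDerivAt (fun s => (γ s).1)
      (derivWithin (fun r => (γ r).1) (Set.Icc 0 1) t) t := fun t ht =>
    ((hγ.differentiableOn one_ne_zero) t (Set.Ioo_subset_Icc_self ht)).hasDerivWithinAt.hasDerivAt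
      (Icc_mem_nhds ht.1 ht.2)
  have hcont : ContinuousOn (fun s => projG n (γ s)) (Set.Icc (0 : ℝ) 1) := by
    have h1 : ContinuousOn (fun t => (γ t).1) (Set.Icc (0 : ℝ) 1) := hγ.continuousOn
    have h2 : ∀ i j, ContinuousOn (fun t => (γ t).1 i j) (Set.Icc (0 : ℝ) 1) := fun i j =>
      (continuous_id.matrix_elem i j).comp_continuousOn h1
    have hu : ∀ j, ContinuousOn (fun t => uFun n (γ t) j) (Set.Icc (0 : ℝ) 1) := by
      intro j
      have hh : ContinuousOn (fun t => hFun n (γ t)) (Set.Icc (0 : ℝ) 1) := by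
        -- A vanishing root would make h zero by the convention 0⁻¹ = 0, contradicting that u is a
        -- unit vector.
        unfold hFun
        refine ContinuousOn.inv₀ (((h2 0 0).norm.pow _).add ((h2 1 0).norm.pow _)).sqrt ?_
        intro t _ h0
        have hz : hFun n (γ t) = 0 := by rw [hFun, h0, inv_zero]
        have := norm_u n (γ t)
        simp [uFun, hz, dotProduct] at this
      unfold uFun
      refine (Complex.continuous_ofReal.comp_continuousOn hh).mul (ContinuousOn.pow ?_ _)
      split_ifs
      · exact h2 j 0
      · exact Complex.continuous_conj.comp_continuousOn (h2 j 0)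
    have key : ContinuousOn (fun t i j => projG n (γ t) i j) (Set.Icc (0 : ℝ) 1) := by
      refine continuousOn_pi.2 fun i => continuousOn_pi.2 fun j => ?_
      exact (hu i).mul (continuous_star.comp_continuousOn (hu j))
    exact key
  refine norm_sub_le_integral_of_norm_deriv_le_of_le zero_le_one hcont ?_ ?_ ?_
  · intro t ht
    obtain ⟨P, hP, -⟩ := exists_hasDerivAt_projG n (hd t ht)
    exact hP.differentiableAt.differentiableWithinAt
  · refine Filter.Eventually.of_forall fun t ht => ?_
    obtain ⟨P, hP, hle⟩ := exists_hasDerivAt_projG n (hd t ht)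
    rw [hP.deriv]
    exact hle
  · refine ContinuousOn.intervalIntegrable ?_
    rw [Set.uIcc_of_le zero_le_one]
    exact continuousOn_const.mul (continuousOn_speed hγ)

theorem lipSeminorm_proj_le (n : ℤ) (hn : n ≠ 0) :
    lipSeminorm (proj n) ≤ ENNReal.ofReal (|(n : ℝ)| * Real.sqrt 2) := by
  have hc : 0 < |(n : ℝ)| * Real.sqrt 2 := by positivity
  refine iSup_le fun a => iSup_le fun b => iSup_le fun _ => ENNReal.div_le_of_le_mul ?_
  unfold sphereEDist
  simp only [ENNReal.mul_iInf_of_ne (ENNReal.ofReal_pos.2 hc).ne' ENNReal.ofReal_ne_top]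
  refine le_iInf fun γ => le_iInf fun hγ => le_iInf fun h0 => le_iInf fun h1 => ?_
  subst h0 h1
  rw [norm_sub_rev]
  exact norm_projG_sub_le n hγ

/-! ### The lower bound: the equator -/

/-- The matrix in `SU(2)` whose class is the point of longitude `2θ` on the equator of `S²`. -/
def equatorMatrix (θ : ℝ) : M2 :=
  ((Real.sqrt 2 : ℝ) : ℂ)⁻¹ • !![Complex.exp (-(θ * Complex.I)), -Complex.exp (-(θ * Complex.I));
    Complex.exp (θ * Complex.I), Complex.exp (θ * Complex.I)]

lemma conj_exp_mul_I (θ : ℝ) :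
    conj (Complex.exp (θ * Complex.I)) = Complex.exp (-(θ * Complex.I)) := by
  rw [← Complex.exp_conj]
  simp

lemma conj_exp_neg_mul_I (θ : ℝ) :
    conj (Complex.exp (-(θ * Complex.I))) = Complex.exp (θ * Complex.I) := by
  rw [← conj_exp_mul_I, Complex.conj_conj]

lemma exp_mul_I_mul_exp_neg (θ : ℝ) :
    Complex.exp (θ * Complex.I) * Complex.exp (-(θ * Complex.I)) = 1 := by
  rw [← Complex.exp_add, add_neg_cancel, Complex.exp_zero]

lemma inv_sqrt_two_sq : (((Real.sqrt 2 : ℝ) : ℂ)⁻¹) ^ 2 = 1 / 2 := by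
  rw [inv_pow, ← Complex.ofReal_pow, Real.sq_sqrt (by norm_num)]
  norm_num

/-- A parametrization of the equator of `S²` by a curve in `SU(2)`. -/
def equator (θ : ℝ) : SU2 :=
  ⟨equatorMatrix θ, by
    have e := exp_mul_I_mul_exp_neg θ
    have r := inv_sqrt_two_sq
    rw [Matrix.mem_specialUnitaryGroup_iff, Matrix.mem_unitaryGroup_iff]
    constructor
    · ext i j
      fin_cases i <;> fin_cases j <;>
        simp [equatorMatrix, Matrix.mul_apply, Matrix.star_apply, conj_exp_mul_I,
          conj_exp_neg_mul_I]
      · linear_combination 2 * ((Real.sqrt 2 : ℝ) : ℂ)⁻¹ ^ 2 * e + 2 * r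
      · linear_combination 2 * ((Real.sqrt 2 : ℝ) : ℂ)⁻¹ ^ 2 * e + 2 * r
    · rw [Matrix.det_fin_two]
      simp [equatorMatrix]
      linear_combination 2 * ((Real.sqrt 2 : ℝ) : ℂ)⁻¹ ^ 2 * e + 2 * r⟩

/-- The derivative of `equatorMatrix`. -/
def equatorDeriv (θ : ℝ) : M2 :=
  ((Real.sqrt 2 : ℝ) : ℂ)⁻¹ • !![-Complex.I * Complex.exp (-(θ * Complex.I)),
      Complex.I * Complex.exp (-(θ * Complex.I));
    Complex.I * Complex.exp (θ * Complex.I), Complex.I * Complex.exp (θ * Complex.I)]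

lemma hasDerivAt_equatorMatrix (θ : ℝ) : HasDerivAt equatorMatrix (equatorDeriv θ) θ := by
  have h0 : HasDerivAt (fun θ : ℝ => (θ : ℂ) * Complex.I) Complex.I θ := by
    simpa using (Complex.ofRealCLM.hasDerivAt (x := θ)).mul_const Complex.I
  have hp := h0.cexp
  have hm := h0.fun_neg.cexp
  have key : HasDerivAt (fun s i j => equatorMatrix s i j) (fun i j => equatorDeriv θ i j) θ := by
    refine hasDerivAt_pi.2 fun i => hasDerivAt_pi.2 fun j => ?_
    fin_cases i <;> fin_cases j
    · refine (hm.const_mul ((Real.sqrt 2 : ℝ) : ℂ)⁻¹).congr_deriv ?_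
      simp [equatorDeriv]; ring
    · refine (hm.fun_neg.const_mul ((Real.sqrt 2 : ℝ) : ℂ)⁻¹).congr_deriv ?_
      simp [equatorDeriv]; ring
    · refine (hp.const_mul ((Real.sqrt 2 : ℝ) : ℂ)⁻¹).congr_deriv ?_
      simp [equatorDeriv]; ring
    · refine (hp.const_mul ((Real.sqrt 2 : ℝ) : ℂ)⁻¹).congr_deriv ?_
      simp [equatorDeriv]; ring
  exact key

lemma contDiff_equatorMatrix : ContDiff ℝ 1 equatorMatrix := by
  have hd : deriv equatorMatrix = equatorDeriv := funext fun θ => (hasDerivAt_equatorMatrix θ).deriv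
  refine contDiff_one_iff_deriv.2 ⟨fun θ => (hasDerivAt_equatorMatrix θ).differentiableAt, ?_⟩
  rw [hd]
  refine continuous_matrix fun i j => ?_
  fin_cases i <;> fin_cases j <;> simp [equatorDeriv] <;> fun_prop

/-- The equatorial arc run from ψ back to 0 has constant speed ψ. Only this upper bound on the
distance is needed, not that the arc is minimal. -/
lemma sphereEDist_equator_le {ψ : ℝ} (hψ : 0 ≤ ψ) :
    sphereEDist (QuotientGroup.mk (equator ψ)) (QuotientGroup.mk (equator 0))
      ≤ ENNReal.ofReal ψ := by
  have hderiv : ∀ t : ℝ, HasDerivAt (fun t : ℝ => (equator (ψ * (1 - t))).1)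
      ((-ψ) • equatorDeriv (ψ * (1 - t))) t := by
    intro t
    have h1 : HasDerivAt (fun t : ℝ => ψ * (1 - t)) (-ψ) t := by
      simpa using ((hasDerivAt_id t).const_sub 1).const_mul ψ
    exact (hasDerivAt_equatorMatrix _).scomp t h1
  have hsmooth : ContDiffOn ℝ 1 (fun t : ℝ => (equator (ψ * (1 - t))).1) (Set.Icc 0 1) := by
    have : ContDiff ℝ 1 (fun t : ℝ => ψ * (1 - t)) := by fun_prop
    exact (contDiff_equatorMatrix.comp this).contDiffOn
  have hspeed : ∀ t ∈ Set.Icc (0 : ℝ) 1, speed (fun t => equator (ψ * (1 - t))) t = ψ := by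
    intro t ht
    rw [speed, (hderiv t).hasDerivWithinAt.derivWithin (uniqueDiffOn_Icc zero_lt_one t ht)]
    set θ := ψ * (1 - t)
    have e := exp_mul_I_mul_exp_neg θ
    have r := inv_sqrt_two_sq
    have h10 : ((equator θ).1.conjTranspose * ((-ψ) • equatorDeriv θ)) 1 0 = -ψ * Complex.I := by
      simp [equator, equatorMatrix, equatorDeriv, Matrix.mul_apply, conj_exp_mul_I,
        conj_exp_neg_mul_I]
      linear_combination (-2 * ψ * Complex.I) * ((Real.sqrt 2 : ℝ) : ℂ)⁻¹ ^ 2 * e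
        - 2 * ψ * Complex.I * r
    have h01 : ((equator θ).1.conjTranspose * ((-ψ) • equatorDeriv θ)) 0 1 = -ψ * Complex.I := by
      simp [equator, equatorMatrix, equatorDeriv, Matrix.mul_apply, conj_exp_mul_I,
        conj_exp_neg_mul_I]
      linear_combination (-2 * ψ * Complex.I) * ((Real.sqrt 2 : ℝ) : ℂ)⁻¹ ^ 2 * e
        - 2 * ψ * Complex.I * r
    rw [gNorm_projM_eq (by rw [h10, h01]), h10]
    simp [abs_of_nonneg hψ]
  have hlen : quotientLength (fun t => equator (ψ * (1 - t))) = ENNReal.ofReal ψ := by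
    rw [quotientLength_eq hsmooth, intervalIntegral.integral_congr (g := fun _ => ψ)]
    · simp
    · rw [Set.uIcc_of_le zero_le_one]
      exact hspeed
  rw [← hlen]
  exact iInf_le_of_le _ (iInf_le_of_le hsmooth (iInf_le_of_le (by simp)
    (iInf_le_of_le (by simp) le_rfl)))

/-- Both coordinates have equal modulus, so the common denominator is 2(ab)^N; the remaining ratio
is (b/a)^N, and 1/a = 2b. -/
lemma lineProj_pow_of_conj {a b : ℂ} (hab : conj a = b) (h : a * b = 1 / 2) (N : ℕ) :
    lineProj (a ^ N) (b ^ N) 0 0 = 1 / 2 ∧ lineProj (a ^ N) (b ^ N) 1 0 = (2 * b ^ 2) ^ N / 2 := by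
  have hba : conj b = a := by rw [← hab, Complex.conj_conj]
  have h1 : a ^ N * b ^ N ≠ 0 := by
    rw [← mul_pow, h]
    exact pow_ne_zero N (by norm_num)
  have h2 : (2 : ℂ) ^ N * (a ^ N * b ^ N) = 1 := by
    rw [← mul_pow, ← mul_pow, h]
    norm_num
  simp only [lineProj, map_pow, hab, hba, Matrix.of_apply, Matrix.cons_val', Matrix.cons_val_zero,
    Matrix.cons_val_one]
  rw [mul_comm (b ^ N) (a ^ N), ← two_mul]
  constructor
  · rw [div_mul_cancel_right₀ h1, one_div]
  · rw [div_eq_div_iff (by simpa using h1) two_ne_zero, mul_pow]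
    linear_combination (-2 * b ^ N * b ^ N) * h2

lemma projG_equator (n : ℤ) (θ : ℝ) :
    projG n (equator θ) 0 0 = 1 / 2 ∧
      projG n (equator θ) 1 0 = Complex.exp (Complex.I * ((2 * n * θ : ℝ) : ℂ)) / 2 := by
  have e := exp_mul_I_mul_exp_neg θ
  have r := inv_sqrt_two_sq
  have h0 : (equator θ).1 0 0 = ((Real.sqrt 2 : ℝ) : ℂ)⁻¹ * Complex.exp (-(θ * Complex.I)) := by
    simp [equator, equatorMatrix]
  have h1 : (equator θ).1 1 0 = ((Real.sqrt 2 : ℝ) : ℂ)⁻¹ * Complex.exp (θ * Complex.I) := by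
    simp [equator, equatorMatrix]
  have hc0 : conj ((equator θ).1 0 0) = (equator θ).1 1 0 := by
    rw [h0, h1, map_mul, conj_exp_neg_mul_I, map_inv₀, Complex.conj_ofReal]
  have hc1 : conj ((equator θ).1 1 0) = (equator θ).1 0 0 := by
    rw [← hc0, Complex.conj_conj]
  have hmul : (equator θ).1 0 0 * (equator θ).1 1 0 = 1 / 2 := by
    rw [h0, h1]
    linear_combination ((Real.sqrt 2 : ℝ) : ℂ)⁻¹ ^ 2 * e + r
  rw [projG_eq_lineProj]
  by_cases hn : 0 < n
  · simp only [hn, if_true]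
    obtain ⟨p, q⟩ := lineProj_pow_of_conj hc0 hmul n.natAbs
    refine ⟨p, q.trans ?_⟩
    have hN : ((n.natAbs : ℕ) : ℂ) = n := by
      rw [← Int.cast_natCast, Int.natAbs_of_nonneg hn.le]
    rw [h1, mul_pow (_⁻¹), r, ← mul_assoc, mul_one_div_cancel two_ne_zero, one_mul, ← pow_mul,
      ← Complex.exp_nat_mul]
    congr 2
    push_cast [hN]
    ring
  -- On this curve conjugation swaps the two coordinates, which accounts for the sign of `n`.
  · simp only [hn, if_false, hc0, hc1]
    obtain ⟨p, q⟩ := lineProj_pow_of_conj hc1 (by rw [mul_comm, hmul]) n.natAbs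
    refine ⟨p, q.trans ?_⟩
    have hN : ((n.natAbs : ℕ) : ℂ) = -n := by
      rw [← Int.cast_natCast, Int.ofNat_natAbs_of_nonpos (not_lt.1 hn), Int.cast_neg]
    rw [h0, mul_pow (_⁻¹), r, ← mul_assoc, mul_one_div_cancel two_ne_zero, one_mul, ← pow_mul,
      ← Complex.exp_nat_mul]
    congr 2
    push_cast [hN]
    ring

/-- The difference is Hermitian and traceless with zero diagonal, so its norm is the modulus of
(exp(2inψ) - 1)/2. -/
lemma norm_projG_equator_sub (n : ℤ) (ψ : ℝ) :
    ‖projG n (equator ψ) - projG n (equator 0)‖ = |Real.sin (n * ψ)| := by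
  have hA : (projG n (equator ψ) - projG n (equator 0)).IsHermitian := by
    rw [projG_eq_lineProj, projG_eq_lineProj]
    exact (isHermitian_lineProj _ _).sub (isHermitian_lineProj _ _)
  have htr : ∀ x : SU2, (projG n x).trace = 1 := by
    intro x
    rw [projG, Matrix.trace_vecMulVec, dotProduct_comm, norm_u]
  have h := norm_sq_of_isHermitian_of_trace_eq_zero hA (by
    rw [Matrix.trace_sub, htr, htr, sub_self])
  obtain ⟨a0, a1⟩ := projG_equator n ψ
  obtain ⟨b0, b1⟩ := projG_equator n 0
  rw [Matrix.sub_apply, Matrix.sub_apply, a0, b0, a1, b1] at h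
  rw [← sq_eq_sq₀ (norm_nonneg _) (abs_nonneg _), h]
  have e : Complex.exp (Complex.I * ((2 * n * ψ : ℝ) : ℂ)) / 2
      - Complex.exp (Complex.I * ((2 * n * (0 : ℝ) : ℝ) : ℂ)) / 2
      = (Complex.exp (Complex.I * ((2 * n * ψ : ℝ) : ℂ)) - 1) / 2 := by
    simp; ring
  rw [e, norm_div, Complex.norm_exp_I_mul_ofReal_sub_one, norm_mul,
    show (2 * n * ψ : ℝ) / 2 = n * ψ by ring]
  simp

theorem le_lipSeminorm_proj (n : ℤ) (hn : n ≠ 0) :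
    ENNReal.ofReal |(n : ℝ)| ≤ lipSeminorm (proj n) := by
  have hd : HasDerivAt (fun ψ : ℝ => Real.sin (n * ψ)) n 0 := by
    have h1 : HasDerivAt (fun ψ : ℝ => (n : ℝ) * ψ) n 0 := by
      simpa using (hasDerivAt_id (0 : ℝ)).const_mul (n : ℝ)
    simpa using h1.sin
  have hlim : Filter.Tendsto (fun ψ : ℝ => |Real.sin (n * ψ)| / ψ) (nhdsWithin 0 (Set.Ioi 0))
      (nhds |(n : ℝ)|) := by
    have h1 := (hasDerivWithinAt_iff_tendsto_slope' (by simp)).1 (hd.hasDerivWithinAt (s := Set.Ioi 0))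
    refine (h1.abs).congr' ?_
    filter_upwards [self_mem_nhdsWithin] with ψ hψ
    have hψ' : (0 : ℝ) < ψ := hψ
    simp [slope_def_field, abs_div, abs_of_pos hψ']
  -- Positivity separates the values of p, hence the two points, without any study of injectivity of
  -- the equator.
  have hne : ∀ᶠ ψ : ℝ in nhdsWithin 0 (Set.Ioi 0), 0 < |Real.sin (n * ψ)| / ψ :=
    hlim.eventually (lt_mem_nhds (by positivity))
  refine le_of_tendsto (ENNReal.tendsto_ofReal hlim) ?_
  filter_upwards [self_mem_nhdsWithin, hne] with ψ hψ hpos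
  have hψ' : (0 : ℝ) < ψ := hψ
  have hval : ‖proj n (QuotientGroup.mk (equator ψ)) - proj n (QuotientGroup.mk (equator 0))‖
      = |Real.sin (n * ψ)| := norm_projG_equator_sub n ψ
  have hab : (QuotientGroup.mk (equator ψ) : S2) ≠ QuotientGroup.mk (equator 0) := by
    intro h
    rw [h, sub_self, norm_zero] at hval
    rw [← hval, zero_div] at hpos
    exact lt_irrefl _ hpos
  rw [ENNReal.ofReal_div_of_pos hψ', ← hval]
  refine (ENNReal.div_le_div_left (sphereEDist_equator_le hψ'.le) _).trans ?_
  exact le_iSup_of_le _ (le_iSup_of_le _ (le_iSup_of_le hab le_rfl))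

end
end Monopole

theorem proposition16p4 (n : ℤ) (hn : n ≠ 0) :
    ENNReal.ofReal |(n : ℝ)| ≤ Monopole.lipSeminorm (Monopole.proj n) ∧
      Monopole.lipSeminorm (Monopole.proj n) ≤ ENNReal.ofReal (|(n : ℝ)| * Real.sqrt 2) :=
  ⟨Monopole.le_lipSeminorm_proj n hn, Monopole.lipSeminorm_proj_le n hn⟩
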